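/- Let $\Delta \ge 1$ be an integer and let $\varepsilon > 0$ be real. There are a deterministic synchronous distributed algorithm $\mathcal A$ and an integer $T$, both depending only on $\Delta$ and $\varepsilon$, such that the following holds for every finite simple graph $G=(V,E)$ with maximum degree at most $\Delta$, every proper colouring of its nodes with two colours (black and white), and every port numbering (each node $v$ numbers its incident edges by $0,\dots,\deg(v)-1$, and the two endpoints of an edge may give it different numbers). Every node runs the same algorithm $\mathcal A$; there are no node identifiers. The initial state of a node depends only on its colour and its degree. In each round every node sends a message through each of its ports, determined by its state and the port, and then computes its new state from its old state and the messages received through its ports. The sets of possible states and messages are finite and depend only on $\Delta$ and $\varepsilon$. After $T$ rounds each node decides, from its state alone, for each of its ports whether the edge behind it is selected. Then the two endpoints of every edge agree, and the selected edges form a matching $M$ such that 1. $M$ is a $(1+\varepsilon)$-approximation of a maximum matching: $|M'| \le (1+\varepsilon)\,|M|$ for every matching $M'$ of $G$; 2. with $k = \lceil 1/\varepsilon\rceil$, there is no augmenting path with respect to $M$ with at most $2k-1$ edges. (An augmenting path is a path with at least one edge that starts and ends at unmatched nodes and whose every other edge, i.e. the second, the fourth, and so on, belongs to $M$.) -/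

import Mathlib

namespace PortLocal

/-- A port numbering of a graph: every node `v` numbers its incident edges (equivalently, its
neighbours) bijectively by `0, ..., deg v - 1`.  The numbers that the two endpoints of an edge give
to the edge are unrelated. -/
structure PortNumbering {V : Type*} (G : SimpleGraph V) [G.LocallyFinite] where
  port : ∀ v : V, G.neighborSet v ≃ Fin (G.degree v)

/-- A deterministic anonymous synchronous algorithm for `2`-coloured port-numbered graphs of maximum
degree at most `Δ`, run in an identical copy on every node.
* `init`: the initial state of a node, a function of its colour and its degree only;
* `send`: the message that a node in a given state sends through a given port;
* `step`: the new state, from the old state and the messages received through the ports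
  (`none` for the ports that the node does not have);
* `output`: which of the incident edges, given by their ports, the node puts into the solution.
The states and the messages range over finite types, fixed before the graph is known, so that memory
and message sizes do not depend on the graph. -/
structure DistAlgorithm (Δ : ℕ) where
  State : Type
  Msg : Type
  finite_state : Finite State
  finite_msg : Finite Msg
  init : Bool → Fin (Δ + 1) → State
  send : State → Fin Δ → Msg
  step : State → (Fin Δ → Option Msg) → State
  output : State → Fin Δ → Bool

section Execution

variable {V : Type*} {G : SimpleGraph V} [G.LocallyFinite] {Δ : ℕ}

/-- The port of `v` that leads to its neighbour `u`, as a number below the degree bound `Δ`. -/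
def PortNumbering.portTo (P : PortNumbering G) (hdeg : ∀ v, G.degree v ≤ Δ)
    {v u : V} (h : G.Adj v u) : Fin Δ :=
  Fin.castLE (hdeg v) (P.port v ⟨u, h⟩)

/-- The neighbour at the other end of port `i` of `v`. -/
def PortNumbering.neighborAt (P : PortNumbering G) (v : V) (i : Fin (G.degree v)) :
    G.neighborSet v :=
  (P.port v).symm i

/-- The messages that arrive at the ports of `v` when the states of the nodes are `x`: through port
`i` the node `v` receives what the neighbour `u` behind that port sends through its own port towards
`v`. -/
def DistAlgorithm.inbox (A : DistAlgorithm Δ) (P : PortNumbering G)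
    (hdeg : ∀ v, G.degree v ≤ Δ) (x : V → A.State) (v : V) (i : Fin Δ) : Option A.Msg :=
  if h : (i : ℕ) < G.degree v then
    let u := P.neighborAt v ⟨i, h⟩
    some (A.send (x u) (P.portTo hdeg (G.adj_symm u.2)))
  else none

/-- The states of all nodes after `t` synchronous communication rounds. -/
def DistAlgorithm.run (A : DistAlgorithm Δ) (P : PortNumbering G)
    (hdeg : ∀ v, G.degree v ≤ Δ) (c : G.Coloring Bool) : ℕ → V → A.State
  | 0, v => A.init (c v) ⟨G.degree v, Nat.lt_succ_of_le (hdeg v)⟩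
  | t + 1, v => A.step (A.run P hdeg c t v) (A.inbox P hdeg (A.run P hdeg c t) v)

/-- After `T` rounds the algorithm outputs the edge set of `M`: every node knows, for each of its
ports, whether the edge behind it belongs to `M` (in particular the two endpoints of an edge
agree). -/
def DistAlgorithm.Outputs (A : DistAlgorithm Δ) (P : PortNumbering G)
    (hdeg : ∀ v, G.degree v ≤ Δ) (c : G.Coloring Bool) (T : ℕ) (M : G.Subgraph) : Prop :=
  ∀ (v u : V) (h : G.Adj v u),
    M.Adj v u ↔ A.output (A.run P hdeg c T v) (P.portTo hdeg h) = true

end Execution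

/-- An augmenting path with respect to `M`: a path with at least one edge, from an unmatched node to
an unmatched node, every other edge of which (the second, the fourth, ...) belongs to `M`. -/
def IsAugmentingPath {V : Type*} {G : SimpleGraph V} (M : G.Subgraph) {a b : V}
    (p : G.Walk a b) : Prop :=
  p.IsPath ∧ 0 < p.length ∧ (∀ w, ¬ M.Adj a w) ∧ (∀ w, ¬ M.Adj b w) ∧
    ∀ i < p.length, M.Adj (p.getVert i) (p.getVert (i + 1)) ↔ Odd i

end PortLocal

/-!
The algorithm is a local version of the Hopcroft–Karp algorithm in which port numbers replace
symmetry breaking.  Call the list of the port numbers (at the tail and at the head of each edge) met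
along an alternating walk its *type*.  A walk of a given type is determined by any one of its nodes
together with the position of this node in the walk.  If there is no augmenting walk with fewer than
`n` edges, then a node cannot have two positions on augmenting walks of length `n`, since otherwise
two of them could be spliced to a shorter one; hence the augmenting walks of one type of length `n`
are pairwise disjoint (`Network.position_unique`) and can be augmented simultaneously without any
further coordination (`Network.IsMatchingRel.augment`).

A new alternating walk that uses a reversed edge of an augmented walk loses two steps against the
old distances (`Network.WalkTo.of_augment`).  So augmenting along a type of length `n` creates
neither shorter augmenting walks nor new ones of length `n`, and it destroys all those of its type.
After all of the finitely many types of length `0, 1, …, 2 * k - 1` have been treated, one after the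
other, no augmenting walk with fewer than `2 * k` edges is left
(`MatchingRule.exists_computedBy`).

Locality is expressed by `DeterminedBy`: the state of a node after `T` rounds determines whether a
predicate holds at the node.  One more round makes predicates of the neighbours behind given ports
available (`DeterminedBy.exists_link`), so the existence of alternating walks of a given type to or
from a node, and with it the augmented matching, is again determined after boundedly many rounds.

For the approximation ratio let `M` be the matching found, `M'` another one, and `a j` the number of
`M`-matched black nodes at alternating distance at most `2 * j` from the unmatched black nodes.
Following an `M'`-edge and then an `M`-edge gives `|M'| ≤ a (j + 1) + (|M| - a j)` for `j < k`, and
summing over `j` gives `k * |M'| ≤ (k + 1) * |M|` (`Network.mul_ncard_black_le`).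
-/

namespace PortLocal

universe u

/-! ### Networks and predicates determined by a run -/

/-- A two-coloured port-numbered graph of maximum degree at most `Δ`, bundled so that predicates can
be compared across different graphs.  The colour `false` is black, `true` is white. -/
structure Network (Δ : ℕ) where
  V : Type u
  G : SimpleGraph V
  [locallyFinite : G.LocallyFinite]
  deg_le : ∀ v, G.degree v ≤ Δ
  color : G.Coloring Bool
  ports : PortNumbering G

attribute [instance] Network.locallyFinite

variable {Δ : ℕ}

namespace Network

/-- The states of the nodes of `N` after `t` rounds of `A`. -/
abbrev run (N : Network.{u} Δ) (A : DistAlgorithm Δ) (t : ℕ) : N.V → A.State :=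
  A.run N.ports N.deg_le N.color t

/-- The port `i` of `v` leads to `w`. -/
def AtPort (N : Network.{u} Δ) (v : N.V) (i : Fin Δ) (w : N.V) : Prop :=
  ∃ h : N.G.Adj v w, N.ports.portTo N.deg_le h = i

/-- `v` and `w` are joined by an edge with number `p` at `v` and number `q` at `w`. -/
def Link (N : Network.{u} Δ) (p q : Fin Δ) (v w : N.V) : Prop :=
  N.AtPort v p w ∧ N.AtPort w q v

variable {N : Network.{u} Δ}

lemma AtPort.eq {v w x : N.V} {i : Fin Δ} (hw : N.AtPort v i w) (hx : N.AtPort v i x) : w = x := by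
  obtain ⟨h, rfl⟩ := hw
  obtain ⟨h', e⟩ := hx
  have := (N.ports.port v).injective (Fin.castLE_injective (N.deg_le v) e)
  exact (congrArg Subtype.val this).symm

lemma Link.symm {p q : Fin Δ} {v w : N.V} (h : N.Link p q v w) : N.Link q p w v := ⟨h.2, h.1⟩

lemma exists_link {v w : N.V} (h : N.G.Adj v w) : ∃ p q, N.Link p q v w :=
  ⟨_, _, ⟨h, rfl⟩, ⟨h.symm, rfl⟩⟩

end Network

/-- The state reached after `T` rounds of `A` determines whether `F` holds at the node, uniformly
over all networks. -/
def DeterminedBy (A : DistAlgorithm Δ) (T : ℕ) (F : ∀ N : Network.{u} Δ, N.V → Prop) : Prop :=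
  ∀ ⦃N N' : Network.{u} Δ⦄ ⦃v : N.V⦄ ⦃v' : N'.V⦄, N.run A T v = N'.run A T v' → (F N v ↔ F N' v')

/-- The algorithm that runs `A` and also remembers the previous state of the node and the previous
states of its neighbours, together with their port numbers. -/
def DistAlgorithm.extend (A : DistAlgorithm Δ) : DistAlgorithm Δ where
  State := A.State × A.State × (Fin Δ → Option (A.State × Fin Δ))
  Msg := A.State × Fin Δ
  finite_state := by
    have := A.finite_state
    infer_instance
  finite_msg := by
    have := A.finite_state
    infer_instance
  init b d := (A.init b d, A.init b d, fun _ => none)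
  send s i := (s.1, i)
  step s m := (A.step s.1 (fun i => (m i).map fun x => A.send x.1 x.2), s.1, m)
  output _ _ := false

lemma run_extend_fst (A : DistAlgorithm Δ) (N : Network.{u} Δ) (t : ℕ) (v : N.V) :
    (N.run A.extend t v).1 = N.run A t v := by
  induction t generalizing v with
  | zero => rfl
  | succ t ih =>
    change A.step (N.run A.extend t v).1 _ = A.step (N.run A t v) _
    rw [ih]
    congr 1
    funext i
    simp only [DistAlgorithm.inbox]
    split
    · refine congrArg some ?_
      change A.send (N.run A.extend t _).1 _ = A.send (N.run A t _) _
      rw [ih]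
      rfl
    · rfl

lemma run_extend_succ_snd_fst (A : DistAlgorithm Δ) (N : Network.{u} Δ) (t : ℕ) (v : N.V) :
    (N.run A.extend (t + 1) v).2.1 = N.run A t v :=
  run_extend_fst A N t v

lemma run_extend_succ_snd_snd (A : DistAlgorithm Δ) (N : Network.{u} Δ) (t : ℕ) (v : N.V)
    (p q : Fin Δ) (s : A.State) :
    (N.run A.extend (t + 1) v).2.2 p = some (s, q) ↔ ∃ w, N.Link p q v w ∧ N.run A t w = s := by
  change A.extend.inbox N.ports N.deg_le (N.run A.extend t) v p = some (s, q) ↔ _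
  simp only [DistAlgorithm.inbox]
  constructor
  · intro h
    split at h
    · rename_i hp
      have h1 := congrArg Prod.fst (Option.some.inj h)
      have h2 := congrArg Prod.snd (Option.some.inj h)
      refine ⟨_, ⟨⟨(N.ports.neighborAt v ⟨p, hp⟩).2, ?_⟩, ⟨_, h2⟩⟩, ?_⟩
      · simp [PortNumbering.portTo, PortNumbering.neighborAt]
      · rw [← run_extend_fst]
        exact h1
    · cases h
  · rintro ⟨w, ⟨⟨h, rfl⟩, ⟨h', rfl⟩⟩, rfl⟩
    have hp : ((N.ports.portTo N.deg_le h : Fin Δ) : ℕ) < N.G.degree v := by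
      simp [PortNumbering.portTo]
    rw [dif_pos hp]
    have key : N.ports.neighborAt v ⟨N.ports.portTo N.deg_le h, hp⟩ = ⟨w, h⟩ := by
      simp [PortNumbering.portTo, PortNumbering.neighborAt]
    refine congrArg some (Prod.ext ?_ ?_)
    · change (N.run A.extend t _).1 = _
      rw [run_extend_fst, key]
    · change N.ports.portTo N.deg_le _ = _
      congr 1
      rw [key]

lemma DeterminedBy.extend {A : DistAlgorithm Δ} {T : ℕ} {F : ∀ N : Network.{u} Δ, N.V → Prop}
    (h : DeterminedBy A T F) : DeterminedBy A.extend (T + 1) F := by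
  intro N N' v v' e
  have := congrArg (fun s : A.extend.State => s.2.1) e
  exact h (by rwa [run_extend_succ_snd_fst, run_extend_succ_snd_fst] at this)

lemma DeterminedBy.exists_link {A : DistAlgorithm Δ} {T : ℕ}
    {F : ∀ N : Network.{u} Δ, N.V → Prop} (h : DeterminedBy A T F) (p q : Fin Δ) :
    DeterminedBy A.extend (T + 1) (fun N v => ∃ w, N.Link p q v w ∧ F N w) := by
  have key : ∀ ⦃N N' : Network.{u} Δ⦄ ⦃v : N.V⦄ ⦃v' : N'.V⦄,
      N.run A.extend (T + 1) v = N'.run A.extend (T + 1) v' →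
      (∃ w, N.Link p q v w ∧ F N w) → ∃ w, N'.Link p q v' w ∧ F N' w := by
    rintro N N' v v' e ⟨w, hw, hF⟩
    have := (run_extend_succ_snd_snd A N T v p q _).2 ⟨w, hw, rfl⟩
    rw [e, run_extend_succ_snd_snd] at this
    obtain ⟨w', hw', e'⟩ := this
    exact ⟨w', hw', (h e').2 hF⟩
  exact fun N N' v v' e => ⟨key e, key e.symm⟩

lemma DeterminedBy.and {A : DistAlgorithm Δ} {T : ℕ} {F F' : ∀ N : Network.{u} Δ, N.V → Prop}
    (h : DeterminedBy A T F) (h' : DeterminedBy A T F') :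
    DeterminedBy A T (fun N v => F N v ∧ F' N v) :=
  fun _ _ _ _ e => and_congr (h e) (h' e)

/-! ### Alternating walks of a given type -/

namespace Network

variable (N : Network.{u} Δ) (R : N.V → N.V → Prop)

/-- The relation `R` is (the adjacency relation of) a matching of `N`. -/
structure IsMatchingRel : Prop where
  adj : ∀ {v w}, R v w → N.G.Adj v w
  symm : ∀ {v w}, R v w → R w v
  unique : ∀ {v w x}, R v w → R v x → w = x

/-- The residual graph of `R`: edges outside `R` are directed from black to white, those in `R` from
white to black.  The alternating walks from unmatched black nodes are its directed walks. -/
def Res (v w : N.V) : Prop := N.G.Adj v w ∧ (R v w ↔ N.color v = true)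

/-- The node `v` has colour `b` and is unmatched by `R`. -/
def Free (b : Bool) (v : N.V) : Prop := N.color v = b ∧ ∀ w, ¬ R v w

/-- There is an alternating walk from an unmatched black node to `v` whose edges have, from the last
one to the first one, the port numbers in the list; `(p, q)` is the number at the tail and at the
head. -/
def WalkTo : List (Fin Δ × Fin Δ) → N.V → Prop
  | [], v => N.Free R false v
  | e :: l, v => ∃ w, N.Link e.2 e.1 v w ∧ N.Res R w v ∧ WalkTo l w

/-- There is an alternating walk from `v` to an unmatched white node whose edges have, from the
first one to the last one, the port numbers in the list. -/
def WalkFrom : List (Fin Δ × Fin Δ) → N.V → Prop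
  | [], v => N.Free R true v
  | e :: l, v => ∃ w, N.Link e.1 e.2 v w ∧ N.Res R v w ∧ WalkFrom l w

/-- There is no augmenting walk with fewer than `n` edges. -/
def NoShort (n : ℕ) : Prop := ∀ l v, N.WalkTo R l v → N.Free R true v → n ≤ l.length

/-- Some augmenting walk of type `σ` traverses the edge from `v` to `w`, in this direction.  The part
`l` of the type before the edge is reversed because `WalkTo` lists the last edge first. -/
def OnAug (σ : List (Fin Δ × Fin Δ)) (v w : N.V) : Prop :=
  ∃ l e m, σ = l.reverse ++ e :: m ∧ N.WalkTo R l v ∧ N.Link e.1 e.2 v w ∧ N.Res R v w ∧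
    N.WalkFrom R m w

/-- The symmetric difference of `R` and of all augmenting walks of type `σ`. -/
def augment (σ : List (Fin Δ × Fin Δ)) (v w : N.V) : Prop :=
  Xor (R v w) (N.OnAug R σ v w ∨ N.OnAug R σ w v)

variable {N R}

lemma color_ne {v w : N.V} (h : N.G.Adj v w) : N.color v ≠ N.color w := N.color.valid h

lemma WalkTo.exists_free {l m : List (Fin Δ × Fin Δ)} {v : N.V} (hl : N.WalkTo R l v)
    (hm : N.WalkFrom R m v) : ∃ w, N.WalkTo R (m.reverse ++ l) w ∧ N.Free R true w := by
  induction m generalizing l v with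
  | nil => exact ⟨v, by simpa using hl, hm⟩
  | cons e m ih =>
    obtain ⟨w, hw, hr, h⟩ := hm
    obtain ⟨x, hx⟩ := ih (l := e :: l) ⟨v, hw.symm, hr, hl⟩ h
    exact ⟨x, by simpa using hx⟩

lemma NoShort.le {n : ℕ} (hn : N.NoShort R n) {l m : List (Fin Δ × Fin Δ)} {v : N.V}
    (hl : N.WalkTo R l v) (hm : N.WalkFrom R m v) : n ≤ l.length + m.length := by
  obtain ⟨w, hw, hf⟩ := hl.exists_free hm
  have := hn _ _ hw hf
  simp at this
  omega

section Augment

variable {σ : List (Fin Δ × Fin Δ)}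

lemma OnAug.res {v w : N.V} (h : N.OnAug R σ v w) : N.Res R v w := by
  obtain ⟨_, _, _, _, _, _, h, _⟩ := h
  exact h

lemma Res.asymm (hR : N.IsMatchingRel R) {v w : N.V} (h : N.Res R v w) : ¬ N.Res R w v := by
  intro h'
  have := color_ne h.1
  have e : R v w ↔ R w v := ⟨hR.symm, hR.symm⟩
  rcases h with ⟨_, h⟩
  rcases h' with ⟨_, h'⟩
  cases hv : N.color v <;> cases hw : N.color w <;> simp_all

/-- Along the edges of a walk of type `σ` the new residual direction is the opposite one. -/
lemma OnAug.augment_iff {v w : N.V} (h : N.OnAug R σ v w) :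
    N.augment R σ v w ↔ N.color v = false := by
  have := h.res.2
  unfold augment Xor
  cases hv : N.color v <;> simp_all

lemma augment_symm (hR : N.IsMatchingRel R) {v w : N.V} (h : N.augment R σ v w) :
    N.augment R σ w v := by
  have e : R v w ↔ R w v := ⟨hR.symm, hR.symm⟩
  unfold augment at *
  rwa [← e, or_comm]

lemma augment_of_not {v w : N.V} (h : ¬ N.OnAug R σ v w) (h' : ¬ N.OnAug R σ w v) :
    N.augment R σ v w ↔ R v w := by
  simp [augment, Xor, h, h']

lemma Res.of_augment {v w : N.V} (h : N.Res (N.augment R σ) v w) :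
    N.Res R v w ∨ N.OnAug R σ w v := by
  by_cases h1 : N.OnAug R σ w v
  · exact .inr h1
  by_cases h2 : N.OnAug R σ v w
  · exact .inl h2.res
  · exact .inl ⟨h.1, (augment_of_not h2 h1).symm.trans h.2⟩

/-- A node has at most one position on the augmenting walks of type `σ`, because otherwise two of
them could be spliced to a shorter one. -/
lemma position_unique (hn : N.NoShort R σ.length) {l l' m m' : List (Fin Δ × Fin Δ)} {v : N.V}
    (hl : N.WalkTo R l v) (hm : N.WalkFrom R m v) (hl' : N.WalkTo R l' v)
    (hm' : N.WalkFrom R m' v) (e : σ = l.reverse ++ m) (e' : σ = l'.reverse ++ m') :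
    l = l' ∧ m = m' := by
  have h1 := hn.le hl hm'
  have h2 := hn.le hl' hm
  have e1 := congrArg List.length e
  have e2 := congrArg List.length e'
  simp only [List.length_append, List.length_reverse] at e1 e2
  have := List.append_inj (e.symm.trans e') (by simp; omega)
  exact ⟨List.reverse_injective this.1, this.2⟩

lemma OnAug.head_unique (hn : N.NoShort R σ.length) {v w x : N.V} (hw : N.OnAug R σ v w)
    (hx : N.OnAug R σ v x) : w = x := by
  obtain ⟨l, e, m, h, hl, hk, hr, hm⟩ := hw
  obtain ⟨l', e', m', h', hl', hk', hr', hm'⟩ := hx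
  have := (position_unique hn hl (m := e :: m) ⟨_, hk, hr, hm⟩ hl' (m' := e' :: m')
    ⟨_, hk', hr', hm'⟩ h h').2
  cases this
  exact hk.1.eq hk'.1

lemma OnAug.tail_unique (hn : N.NoShort R σ.length) {v w x : N.V} (hw : N.OnAug R σ w v)
    (hx : N.OnAug R σ x v) : w = x := by
  obtain ⟨l, e, m, h, hl, hk, hr, hm⟩ := hw
  obtain ⟨l', e', m', h', hl', hk', hr', hm'⟩ := hx
  have := (position_unique hn (l := e :: l) ⟨_, hk.symm, hr, hl⟩ hm (l' := e' :: l')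
    ⟨_, hk'.symm, hr', hl'⟩ hm' (by simp [h]) (by simp [h'])).1
  cases this
  exact hk.2.eq hk'.2

/-- A node on a walk of type `σ` is unmatched and black or has a predecessor. -/
lemma OnAug.pred {v w : N.V} (h : N.OnAug R σ v w) :
    N.Free R false v ∨ ∃ x, N.OnAug R σ x v := by
  obtain ⟨l, e, m, h, hl, hk, hr, hm⟩ := h
  cases l with
  | nil => exact .inl hl
  | cons e' l =>
    obtain ⟨x, hx, hr', hl⟩ := hl
    exact .inr ⟨x, l, e', e :: m, by simpa using h, hl, hx.symm, hr', _, hk, hr, hm⟩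

/-- A node on a walk of type `σ` is unmatched and white or has a successor. -/
lemma OnAug.succ {v w : N.V} (h : N.OnAug R σ w v) :
    N.Free R true v ∨ ∃ x, N.OnAug R σ v x := by
  obtain ⟨l, e, m, h, hl, hk, hr, hm⟩ := h
  cases m with
  | nil => exact .inl hm
  | cons e' m =>
    obtain ⟨x, hx, hr', hm⟩ := hm
    exact .inr ⟨x, e :: l, e', m, by simpa using h, ⟨_, hk.symm, hr, hl⟩, hx, hr', hm⟩

lemma augment_black (hR : N.IsMatchingRel R) {v w : N.V} (hv : N.color v = false) :
    N.augment R σ v w ↔ (R v w ∧ ¬ N.OnAug R σ w v) ∨ N.OnAug R σ v w := by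
  by_cases h1 : N.OnAug R σ v w
  · simp [h1, h1.augment_iff, hv]
  by_cases h2 : N.OnAug R σ w v
  · have := h2.res.1
    have hne := color_ne this
    have := h2.augment_iff
    have : ¬ N.augment R σ v w := fun h => by
      have := this.1 (augment_symm hR h)
      simp_all
    simp [h1, h2, this]
  · simp [augment_of_not h1 h2, h1, h2]

lemma augment_white (hR : N.IsMatchingRel R) {v w : N.V} (hv : N.color v = true) :
    N.augment R σ v w ↔ (R v w ∧ ¬ N.OnAug R σ v w) ∨ N.OnAug R σ w v := by
  by_cases h1 : N.OnAug R σ v w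
  · have h2 : ¬ N.OnAug R σ w v := fun h => h1.res.asymm hR h.res
    simp [h1, h2, h1.augment_iff, hv]
  by_cases h2 : N.OnAug R σ w v
  · have hne := color_ne h2.res.1
    have : N.augment R σ v w := augment_symm hR ((h2.augment_iff).2 (by simp_all))
    simp [h2, this]
  · simp [augment_of_not h1 h2, h1, h2]

lemma IsMatchingRel.augment (hR : N.IsMatchingRel R) (hn : N.NoShort R σ.length) :
    N.IsMatchingRel (N.augment R σ) where
  adj {v w} h := by
    by_cases h1 : N.OnAug R σ v w
    · exact h1.res.1
    by_cases h2 : N.OnAug R σ w v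
    · exact h2.res.1.symm
    · exact hR.adj ((augment_of_not h1 h2).1 h)
  symm := augment_symm hR
  unique {v w x} hw hx := by
    -- the matched edge at an inner node of a walk is the walk edge before or after it
    cases hv : N.color v
    · have key : ∀ {w x}, R v w → ¬ N.OnAug R σ w v → ¬ N.OnAug R σ v x := by
        intro w x h1 h2 h3
        rcases h3.pred with h4 | ⟨y, hy⟩
        · exact h4.2 _ h1
        · have hne := color_ne hy.res.1
          have : R y v := hy.res.2.2 (by simp_all)
          exact h2 (hR.unique (hR.symm this) h1 ▸ hy)
      rw [augment_black hR hv] at hw hx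
      rcases hw with hw | hw <;> rcases hx with hx | hx
      · exact hR.unique hw.1 hx.1
      · exact (key hw.1 hw.2 hx).elim
      · exact (key hx.1 hx.2 hw).elim
      · exact hw.head_unique hn hx
    · have key : ∀ {w x}, R v w → ¬ N.OnAug R σ v w → ¬ N.OnAug R σ x v := by
        intro w x h1 h2 h3
        rcases h3.succ with h4 | ⟨y, hy⟩
        · exact h4.2 _ h1
        · exact h2 (hR.unique (hy.res.2.2 hv) h1 ▸ hy)
      rw [augment_white hR hv] at hw hx
      rcases hw with hw | hw <;> rcases hx with hx | hx
      · exact hR.unique hw.1 hx.1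
      · exact (key hw.1 hw.2 hx).elim
      · exact (key hx.1 hx.2 hw).elim
      · exact hw.tail_unique hn hx

lemma exists_augment (hR : N.IsMatchingRel R) {v w : N.V} (h : R v w) :
    ∃ x, N.augment R σ v x := by
  cases hv : N.color v
  · simp only [augment_black hR hv]
    by_cases h1 : N.OnAug R σ w v
    · rcases h1.succ with h2 | ⟨x, hx⟩
      · exact (h2.2 _ h).elim
      · exact ⟨x, .inr hx⟩
    · exact ⟨w, .inl ⟨h, h1⟩⟩
  · simp only [augment_white hR hv]
    by_cases h1 : N.OnAug R σ v w
    · rcases h1.pred with h2 | ⟨x, hx⟩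
      · exact (h2.2 _ h).elim
      · exact ⟨x, .inr hx⟩
    · exact ⟨w, .inl ⟨h, h1⟩⟩

lemma Free.of_augment (hR : N.IsMatchingRel R) {b : Bool} {v : N.V}
    (h : N.Free (N.augment R σ) b v) : N.Free R b v :=
  ⟨h.1, fun _ hw => (exists_augment hR hw).elim h.2⟩

/-- An alternating walk for the new matching that is not one for the old matching traverses an edge
of a shortest augmenting walk backwards, and therefore loses two steps against the distances in the
old residual graph. -/
lemma WalkTo.of_augment (hR : N.IsMatchingRel R) (hn : N.NoShort R σ.length)
    {l : List (Fin Δ × Fin Δ)} {v : N.V} (h : N.WalkTo (N.augment R σ) l v) :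
    N.WalkTo R l v ∨ ∃ l', N.WalkTo R l' v ∧ l'.length + 2 ≤ l.length := by
  induction l generalizing v with
  | nil => exact .inl (Free.of_augment hR h)
  | cons e l ih =>
    obtain ⟨w, hk, hr, hl⟩ := h
    rcases hr.of_augment with hr | ho
    · rcases ih hl with h | ⟨l', h, hle⟩
      · exact .inl ⟨w, hk, hr, h⟩
      · exact .inr ⟨e :: l', ⟨w, hk, hr, h⟩, by simpa using hle⟩
    · obtain ⟨γ, e', m, hσ, hγ, -, -, hm⟩ := ho
      obtain ⟨δ, hδ, hle⟩ : ∃ δ, N.WalkTo R δ w ∧ δ.length ≤ l.length := by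
        rcases ih hl with h | ⟨l', h, hle⟩
        · exact ⟨l, h, le_rfl⟩
        · exact ⟨l', h, by omega⟩
      have h1 := hn.le hδ hm
      have h2 := congrArg List.length hσ
      simp only [List.length_append, List.length_reverse, List.length_cons] at h2 ⊢
      exact .inr ⟨γ, hγ, by omega⟩

lemma NoShort.augment (hR : N.IsMatchingRel R) (hn : N.NoShort R σ.length) :
    N.NoShort (N.augment R σ) σ.length := by
  intro l v hl hv
  rcases hl.of_augment hR hn with h | ⟨l', h, hle⟩
  · exact hn _ _ h (hv.of_augment hR)
  · have := hn _ _ h (hv.of_augment hR)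
    omega

/-- Augmenting along the type `σ` creates no augmenting walk of the same length. -/
lemma WalkTo.of_augment_of_length_eq (hR : N.IsMatchingRel R) (hn : N.NoShort R σ.length)
    {l : List (Fin Δ × Fin Δ)} {v : N.V} (h : N.WalkTo (N.augment R σ) l v)
    (hv : N.Free (N.augment R σ) true v) (hl : l.length = σ.length) : N.WalkTo R l v := by
  rcases h.of_augment hR hn with h | ⟨l', h, hle⟩
  · exact h
  · have := hn _ _ h (hv.of_augment hR)
    omega

/-- Augmenting along the type `σ` destroys all augmenting walks of this type. -/
lemma not_walkTo_augment (hR : N.IsMatchingRel R) (hn : N.NoShort R σ.length)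
    {l : List (Fin Δ × Fin Δ)} {v : N.V} (hv : N.Free (N.augment R σ) true v)
    (hl : l.reverse = σ) : ¬ N.WalkTo (N.augment R σ) l v := by
  intro h
  have h' := h.of_augment_of_length_eq hR hn hv (by simp [← hl])
  have hv' := hv.of_augment hR
  cases l with
  | nil => simpa [hv'.1] using h'.1
  | cons e l =>
    obtain ⟨w, hk, hr, -⟩ := h
    obtain ⟨w', hk', hr', hl'⟩ := h'
    obtain rfl := hk.1.eq hk'.1
    have ho : N.OnAug R σ w v := ⟨l, e, [], by simp [← hl], hl', hk.symm, hr', hv'⟩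
    have h1 := hr.2
    rw [ho.augment_iff] at h1
    cases hw : N.color w <;> simp [hw] at h1

end Augment

end Network

/-! ### Locality of the augmentation -/

/-- A rule that assigns a matching to every network. -/
abbrev MatchingRule (Δ : ℕ) := ∀ N : Network.{u} Δ, N.V → N.V → Prop

/-- After `T` rounds of `A` every node knows behind which of its ports the matching `M` has an
edge. -/
def MatchingRule.KnownBy (M : MatchingRule.{u} Δ) (A : DistAlgorithm Δ) (T : ℕ) : Prop :=
  ∀ i, DeterminedBy A T (fun N v => ∃ w, N.AtPort v i w ∧ M N v w)

namespace Network

variable {N : Network.{u} Δ} {R : N.V → N.V → Prop}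

lemma AtPort.exists_iff {v w : N.V} {i : Fin Δ} (h : N.AtPort v i w) {F : N.V → Prop} :
    (∃ x, N.AtPort v i x ∧ F x) ↔ F w :=
  ⟨fun ⟨_, hx, hF⟩ => h.eq hx ▸ hF, fun hF => ⟨w, h, hF⟩⟩

lemma free_iff (hR : N.IsMatchingRel R) {b : Bool} {v : N.V} :
    N.Free R b v ↔ N.color v = b ∧ ∀ i, ¬ ∃ w, N.AtPort v i w ∧ R v w := by
  refine and_congr_right fun _ => ⟨fun h _ ⟨w, _, hw⟩ => h w hw, fun h w hw => ?_⟩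
  exact h _ ⟨w, ⟨hR.adj hw, rfl⟩, hw⟩

lemma walkTo_cons_iff {e : Fin Δ × Fin Δ} {l : List (Fin Δ × Fin Δ)} {v : N.V} :
    N.WalkTo R (e :: l) v ↔ ∃ w, N.Link e.2 e.1 v w ∧
      (((∃ x, N.AtPort w e.1 x ∧ R w x) ↔ N.color w = true) ∧ N.WalkTo R l w) := by
  refine exists_congr fun w => and_congr_right fun hk => ?_
  rw [hk.2.exists_iff, Res, and_iff_right hk.2.1, and_comm, and_comm]

lemma walkFrom_cons_iff {e : Fin Δ × Fin Δ} {l : List (Fin Δ × Fin Δ)} {v : N.V} :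
    N.WalkFrom R (e :: l) v ↔ ((∃ x, N.AtPort v e.1 x ∧ R v x) ↔ N.color v = true) ∧
      ∃ w, N.Link e.1 e.2 v w ∧ N.WalkFrom R l w := by
  constructor
  · rintro ⟨w, hk, hr, h⟩
    exact ⟨by rw [hk.1.exists_iff]; exact hr.2, w, hk, h⟩
  · rintro ⟨hr, w, hk, h⟩
    rw [hk.1.exists_iff] at hr
    exact ⟨w, hk, ⟨hk.1.1, hr⟩, h⟩

lemma onAug_iff {σ : List (Fin Δ × Fin Δ)} {v w : N.V} {i : Fin Δ} (h : N.AtPort v i w) :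
    N.OnAug R σ v w ↔ ∃ l q m, σ = l.reverse ++ (i, q) :: m ∧ N.WalkTo R l v ∧
      N.WalkFrom R ((i, q) :: m) v := by
  constructor
  · rintro ⟨l, ⟨p, q⟩, m, hσ, hl, hk, hr, hm⟩
    obtain ⟨h', rfl⟩ := h
    obtain ⟨⟨_, rfl⟩, hq⟩ := hk
    exact ⟨l, q, m, hσ, hl, w, ⟨⟨h', rfl⟩, hq⟩, hr, hm⟩
  · rintro ⟨l, q, m, hσ, hl, x, hk, hr, hm⟩
    obtain rfl := h.eq hk.1
    exact ⟨l, (i, q), m, hσ, hl, hk, hr, hm⟩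

lemma onAug_iff_rev {σ : List (Fin Δ × Fin Δ)} {v w : N.V} {i : Fin Δ} (h : N.AtPort v i w) :
    N.OnAug R σ w v ↔ ∃ l p m, σ = l.reverse ++ (p, i) :: m ∧ N.WalkTo R ((p, i) :: l) v ∧
      N.WalkFrom R m v := by
  constructor
  · rintro ⟨l, ⟨p, q⟩, m, hσ, hl, hk, hr, hm⟩
    obtain ⟨h', rfl⟩ := h
    obtain ⟨hp, ⟨_, rfl⟩⟩ := hk
    exact ⟨l, p, m, hσ, ⟨w, ⟨⟨h', rfl⟩, hp⟩, hr, hl⟩, hm⟩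
  · rintro ⟨l, p, m, hσ, ⟨x, hk, hr, hl⟩, hm⟩
    obtain rfl := h.eq hk.1
    exact ⟨l, (p, i), m, hσ, hl, hk.symm, hr, hm⟩

lemma exists_augment_iff {σ : List (Fin Δ × Fin Δ)} {v : N.V} {i : Fin Δ} :
    (∃ w, N.AtPort v i w ∧ N.augment R σ v w) ↔
      Xor (∃ w, N.AtPort v i w ∧ R v w)
        ((∃ l q m, σ = l.reverse ++ (i, q) :: m ∧ N.WalkTo R l v ∧
          N.WalkFrom R ((i, q) :: m) v) ∨
        ∃ l p m, σ = l.reverse ++ (p, i) :: m ∧ N.WalkTo R ((p, i) :: l) v ∧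
          N.WalkFrom R m v) := by
  have key : ∀ {w}, N.AtPort v i w → ((∃ w, N.AtPort v i w ∧ N.augment R σ v w) ↔ _) :=
    fun {w} hw => by rw [hw.exists_iff, augment, onAug_iff hw, onAug_iff_rev hw,
      ← hw.exists_iff (F := R v)]
  refine ⟨fun h => ?_, fun h => ?_⟩
  · obtain ⟨w, hw, -⟩ := id h
    exact (key hw).1 h
  · have : ∃ w, N.AtPort v i w := by
      rcases h with ⟨⟨w, hw, -⟩, -⟩ | ⟨⟨_, _, _, _, _, w, hw, _⟩ | ⟨_, _, _, _, ⟨w, hw, _⟩, _⟩, -⟩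
      exacts [⟨w, hw⟩, ⟨w, hw.1⟩, ⟨w, hw.1⟩]
    exact (key this.choose_spec).2 h

end Network

/-- The algorithm that knows the colours and nothing else. -/
def DistAlgorithm.colorOnly (Δ : ℕ) : DistAlgorithm Δ where
  State := Bool
  Msg := Unit
  finite_state := inferInstance
  finite_msg := inferInstance
  init b _ := b
  send _ _ := ()
  step s _ := s
  output _ _ := false

/-- An algorithm that knows a matching extends to one whose states also determine, for every type of
length at most `n`, whether an alternating walk of this type leads to or from the node. -/
lemma MatchingRule.KnownBy.exists_walk {M : MatchingRule.{u} Δ} {A : DistAlgorithm Δ} {T : ℕ}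
    (hR : ∀ N : Network.{u} Δ, N.IsMatchingRel (M N)) (hM : M.KnownBy A T)
    (hc : ∀ b, DeterminedBy.{u} A T (fun N v => N.color v = b)) (n : ℕ) :
    ∃ A' T', M.KnownBy A' T' ∧ (∀ b, DeterminedBy.{u} A' T' (fun N v => N.color v = b)) ∧
      ∀ l : List (Fin Δ × Fin Δ), l.length ≤ n →
        DeterminedBy A' T' (fun N v => N.WalkTo (M N) l v) ∧
        DeterminedBy A' T' (fun N v => N.WalkFrom (M N) l v) := by
  induction n with
  | zero =>
    refine ⟨A, T, hM, hc, fun l hl => ?_⟩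
    obtain rfl := List.length_eq_zero_iff.1 (Nat.le_zero.1 hl)
    have hf : ∀ b, DeterminedBy A T (fun N v => N.Free (M N) b v) := by
      intro b N N' v v' he
      simp only [Network.free_iff (hR _)]
      exact and_congr (hc b he) (forall_congr' fun i => not_congr (hM i he))
    exact ⟨hf false, hf true⟩
  | succ n ih =>
    obtain ⟨A', T', hM', hc', h⟩ := ih
    refine ⟨A'.extend, T' + 1, fun i => (hM' i).extend, fun b => (hc' b).extend, fun l hl => ?_⟩
    cases l with
    | nil => exact ⟨(h [] (by simp)).1.extend, (h [] (by simp)).2.extend⟩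
    | cons e l =>
      obtain ⟨h1, h2⟩ := h l (by simpa using hl)
      have hm : DeterminedBy A' T' (fun N v =>
          (∃ x, N.AtPort v e.1 x ∧ M N v x) ↔ N.color v = true) :=
        fun _ _ _ _ he => iff_congr (hM' e.1 he) (hc' true he)
      simp only [Network.walkTo_cons_iff, Network.walkFrom_cons_iff]
      exact ⟨(hm.and h1).exists_link e.2 e.1, hm.extend.and (h2.exists_link e.1 e.2)⟩

namespace MatchingRule

/-- The invariant of the construction: after `T` rounds of `A` every node knows its colour and the
edges of `M` at it, and there are no `M`-augmenting walks with fewer than `n` edges. -/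
structure ComputedBy (M : MatchingRule.{u} Δ) (A : DistAlgorithm Δ) (T n : ℕ) : Prop where
  isMatchingRel : ∀ N : Network.{u} Δ, N.IsMatchingRel (M N)
  knownBy : M.KnownBy A T
  color : ∀ b, DeterminedBy.{u} A T (fun N v => N.color v = b)
  noShort : ∀ N : Network.{u} Δ, N.NoShort (M N) n

lemma ComputedBy.augment {M : MatchingRule.{u} Δ} {A : DistAlgorithm Δ} {T : ℕ}
    {σ : List (Fin Δ × Fin Δ)} (h : M.ComputedBy A T σ.length) :
    ∃ A' T', ComputedBy (fun N => N.augment (M N) σ) A' T' σ.length := by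
  obtain ⟨A', T', hM, hc, hw⟩ := h.knownBy.exists_walk h.isMatchingRel h.color σ.length
  refine ⟨A', T', fun N => (h.isMatchingRel N).augment (h.noShort N), fun i => ?_, hc,
    fun N => (h.noShort N).augment (h.isMatchingRel N)⟩
  intro N N' v v' he
  have hle : ∀ {l m : List (Fin Δ × Fin Δ)} {e}, σ = l.reverse ++ e :: m →
      l.length + 1 ≤ σ.length ∧ m.length + 1 ≤ σ.length := by
    rintro l m e rfl
    simp
  simp only [Network.exists_augment_iff]
  refine iff_of_eq (congrArg₂ Xor (propext (hM i he)) (propext (or_congr ?_ ?_)))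
  · refine exists_congr fun l => exists_congr fun q => exists_congr fun m =>
      and_congr_right fun hσ => and_congr ((hw l ?_).1 he) ((hw _ ?_).2 he)
    · exact (Nat.le_succ _).trans (hle hσ).1
    · exact (hle hσ).2
  · refine exists_congr fun l => exists_congr fun p => exists_congr fun m =>
      and_congr_right fun hσ => and_congr ((hw _ ?_).1 he) ((hw m ?_).2 he)
    · exact (hle hσ).1
    · exact (Nat.le_succ _).trans (hle hσ).2

/-- Augmenting along the types in a list one after the other destroys all augmenting walks of these
types. -/
lemma ComputedBy.exists_of_list {M : MatchingRule.{u} Δ} {A : DistAlgorithm Δ} {T n : ℕ}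
    (h : M.ComputedBy A T n) (L : List (List (Fin Δ × Fin Δ))) (hL : ∀ σ ∈ L, σ.length = n) :
    ∃ (M' : MatchingRule.{u} Δ) (A' : DistAlgorithm Δ) (T' : ℕ), M'.ComputedBy A' T' n ∧
      ∀ (N : Network.{u} Δ) l v, l.reverse ∈ L → N.Free (M' N) true v →
        ¬ N.WalkTo (M' N) l v := by
  induction L with
  | nil => exact ⟨M, A, T, h, by simp⟩
  | cons σ L ih =>
    obtain ⟨M', A', T', h', hn⟩ := ih fun τ hτ => hL τ (List.mem_cons_of_mem _ hτ)
    obtain rfl := hL σ List.mem_cons_self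
    obtain ⟨A'', T'', h''⟩ := h'.augment
    refine ⟨_, A'', T'', h'', fun N l v hl hv hw => ?_⟩
    have hR := h'.isMatchingRel N
    have hs := h'.noShort N
    rcases List.mem_cons.1 hl with e | hl'
    · exact Network.not_walkTo_augment hR hs hv e hw
    · exact hn N l v hl' (hv.of_augment hR)
        (hw.of_augment_of_length_eq hR hs hv (by simpa using hL _ hl))

lemma ComputedBy.exists_succ {M : MatchingRule.{u} Δ} {A : DistAlgorithm Δ} {T n : ℕ}
    (h : M.ComputedBy A T n) :
    ∃ (M' : MatchingRule.{u} Δ) (A' : DistAlgorithm Δ) (T' : ℕ), M'.ComputedBy A' T' (n + 1) := by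
  have hfin := List.finite_length_eq (Fin Δ × Fin Δ) n
  obtain ⟨M', A', T', h', hn⟩ := h.exists_of_list hfin.toFinset.toList (by simp)
  refine ⟨M', A', T', h'.isMatchingRel, h'.knownBy, h'.color, fun N l v hl hv => ?_⟩
  refine lt_of_le_of_ne (h'.noShort N l v hl hv) fun e => hn N l v ?_ hv hl
  simp [e]

lemma exists_computedBy (Δ n : ℕ) :
    ∃ (M : MatchingRule.{u} Δ) (A : DistAlgorithm Δ) (T : ℕ), M.ComputedBy A T n := by
  induction n with
  | zero =>
    refine ⟨fun _ _ _ => False, DistAlgorithm.colorOnly Δ, 0, fun N => ?_, fun i => ?_, ?_, ?_⟩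
    · exact ⟨False.elim, False.elim, fun h => h.elim⟩
    · intro N N' v v' _
      simp
    · intro b N N' v v' (he : N.color v = N'.color v')
      simp only [he]
    · exact fun N l v _ _ => Nat.zero_le _
  | succ n ih =>
    obtain ⟨M, A, T, h⟩ := ih
    exact h.exists_succ

open Classical in
/-- The output function looks for some network in which the given state occurs; by `h` it does not
matter which one is found. -/
lemma KnownBy.exists_outputs {M : MatchingRule.{u} Δ} {A : DistAlgorithm Δ} {T : ℕ}
    (h : M.KnownBy A T) : ∃ A' : DistAlgorithm Δ, ∀ (N : Network.{u} Δ) (v w : N.V)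
      (hvw : N.G.Adj v w),
      M N v w ↔ A'.output (N.run A' T v) (N.ports.portTo N.deg_le hvw) = true := by
  let A' : DistAlgorithm Δ :=
    { A with
      output := fun s i => decide (∃ (N : Network.{u} Δ) (v : N.V),
        N.run A T v = s ∧ ∃ w, N.AtPort v i w ∧ M N v w) }
  have hrun : ∀ (N : Network.{u} Δ) t, N.run A' t = N.run A t := by
    intro N t
    induction t with
    | zero => rfl
    | succ t ih =>
      funext v
      change A.step (N.run A' t v) (A.inbox N.ports N.deg_le (N.run A' t) v) = _
      rw [ih]
      rfl
  refine ⟨A', fun N v w hvw => ?_⟩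
  have hp : N.AtPort v (N.ports.portTo N.deg_le hvw) w := ⟨hvw, rfl⟩
  rw [hrun]
  change _ ↔ decide _ = true
  rw [decide_eq_true_iff]
  constructor
  · exact fun hm => ⟨N, v, rfl, w, hp, hm⟩
  · rintro ⟨N', v', he, hw⟩
    exact hp.exists_iff.1 ((h _ he).1 hw)

end MatchingRule

namespace Network

variable {N : Network.{u} Δ} {R R' : N.V → N.V → Prop}

/-! ### The size of a matching without short augmenting walks -/

/-- The nodes at alternating distance at most `n` from the unmatched black nodes. -/
def Near (N : Network.{u} Δ) (R : N.V → N.V → Prop) (n : ℕ) : Set N.V :=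
  {v | ∃ l, N.WalkTo R l v ∧ l.length ≤ n}

lemma Near.step {n : ℕ} {v w : N.V} (hv : v ∈ N.Near R n) (h : N.Res R v w) :
    w ∈ N.Near R (n + 1) := by
  obtain ⟨l, hl, hn⟩ := hv
  obtain ⟨p, q, hk⟩ := exists_link h.1
  exact ⟨(p, q) :: l, ⟨v, hk.symm, h, hl⟩, by simpa using hn⟩

/-- The black nodes matched by `R`. -/
def Black (N : Network.{u} Δ) (R : N.V → N.V → Prop) : Set N.V :=
  {v | N.color v = false ∧ ∃ w, R v w}

/-- Following an edge of `R'` and then an edge of `R` maps the `R'`-matched black nodes at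
distance at most `n` injectively to `R`-matched ones at distance at most `n + 2`. -/
lemma ncard_black_inter_near_le [Finite N.V] (hR : N.IsMatchingRel R) (hR' : N.IsMatchingRel R')
    {n : ℕ} (hn : N.NoShort R (n + 2)) :
    (N.Black R' ∩ N.Near R n).ncard ≤ (N.Black R ∩ N.Near R (n + 2)).ncard := by
  have key : ∀ v ∈ N.Black R' ∩ N.Near R n, ∃ w x, R' v w ∧ R w x ∧
      x ∈ N.Black R ∩ N.Near R (n + 2) := by
    rintro v ⟨⟨hv, w, hw⟩, hnear⟩
    have hc := color_ne (hR'.adj hw)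
    have hcw : N.color w = true := by simp_all
    by_cases h : R v w
    · obtain ⟨l, hl, hle⟩ := hnear
      exact ⟨w, v, hw, hR.symm h, ⟨hv, w, h⟩, l, hl, by omega⟩
    · have hw1 : w ∈ N.Near R (n + 1) := Near.step hnear ⟨hR'.adj hw, by simp [h, hv]⟩
      obtain ⟨x, hx⟩ : ∃ x, R w x := by
        by_contra hx
        obtain ⟨l, hl, hle⟩ := hw1
        have := hn l w hl ⟨hcw, fun x h => hx ⟨x, h⟩⟩
        omega
      have hc' := color_ne (hR.adj hx)
      exact ⟨w, x, hw, hx, ⟨by simp_all, w, hR.symm hx⟩,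
        Near.step hw1 ⟨hR.adj hx, by simp [hx, hcw]⟩⟩
  choose! f g hf hg hmem using key
  refine Set.ncard_le_ncard_of_injOn g hmem (fun v hv w hw e => ?_) (Set.toFinite _)
  have h1 := hg v hv
  have h2 := hg w hw
  rw [← e] at h2
  have h3 := hf w hw
  rw [hR.unique (hR.symm h2) (hR.symm h1)] at h3
  exact hR'.unique (hR'.symm (hf v hv)) (hR'.symm h3)

lemma ncard_black_add_le [Finite N.V] (hR : N.IsMatchingRel R) (hR' : N.IsMatchingRel R')
    {n : ℕ} (hn : N.NoShort R (n + 2)) :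
    (N.Black R').ncard + (N.Black R ∩ N.Near R n).ncard ≤
      (N.Black R ∩ N.Near R (n + 2)).ncard + (N.Black R).ncard := by
  have h1 := Set.ncard_inter_add_ncard_sdiff_eq_ncard (N.Black R') (N.Near R n)
  have h2 := Set.ncard_inter_add_ncard_sdiff_eq_ncard (N.Black R) (N.Near R n)
  have h3 := ncard_black_inter_near_le hR hR' hn
  -- a black node far from the unmatched black nodes is matched
  have h4 : (N.Black R' \ N.Near R n).ncard ≤ (N.Black R \ N.Near R n).ncard := by
    refine Set.ncard_le_ncard (fun v hv => ⟨⟨hv.1.1, ?_⟩, hv.2⟩) (Set.toFinite _)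
    by_contra h
    exact hv.2 ⟨[], ⟨hv.1.1, fun w hw => h ⟨w, hw⟩⟩, Nat.zero_le _⟩
  omega

/-- Adding up the previous inequalities for `n = 0, 2, …, 2 * k - 2`, the layers telescope. -/
lemma mul_ncard_black_le [Finite N.V] (hR : N.IsMatchingRel R) (hR' : N.IsMatchingRel R') {k : ℕ}
    (hk : N.NoShort R (2 * k)) :
    k * (N.Black R').ncard ≤ (k + 1) * (N.Black R).ncard := by
  have key : ∀ j ≤ k, j * (N.Black R').ncard ≤
      j * (N.Black R).ncard + (N.Black R ∩ N.Near R (2 * j)).ncard := by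
    intro j
    induction j with
    | zero => simp
    | succ j ih =>
      intro hj
      have h1 := ih (by omega)
      have h2 := ncard_black_add_le (n := 2 * j) hR hR'
        fun l v hl hv => le_trans (by omega) (hk l v hl hv)
      rw [show 2 * (j + 1) = 2 * j + 2 by ring, add_one_mul, add_one_mul]
      omega
  have h1 := key k le_rfl
  have h2 : (N.Black R ∩ N.Near R (2 * k)).ncard ≤ (N.Black R).ncard :=
    Set.ncard_le_ncard Set.inter_subset_left (Set.toFinite _)
  rw [add_one_mul]
  omega

/-- The matching `R` as a subgraph. -/
def IsMatchingRel.toSubgraph (hR : N.IsMatchingRel R) : N.G.Subgraph where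
  verts := {v | ∃ w, R v w}
  Adj := R
  adj_sub := hR.adj
  edge_vert h := ⟨_, h⟩
  symm := ⟨fun _ _ => hR.symm⟩

lemma IsMatchingRel.isMatching (hR : N.IsMatchingRel R) : hR.toSubgraph.IsMatching :=
  fun _ ⟨w, hw⟩ => ⟨w, hw, fun _ hx => hR.unique hx hw⟩

lemma isMatchingRel_adj {M : N.G.Subgraph} (hM : M.IsMatching) : N.IsMatchingRel M.Adj where
  adj h := h.adj_sub
  symm h := h.symm
  unique h h' := hM.eq_of_adj_left h h'

/-- Every edge of a matching has exactly one black end. -/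
lemma ncard_edgeSet {M : N.G.Subgraph} (hM : M.IsMatching) :
    M.edgeSet.ncard = (N.Black M.Adj).ncard := by
  symm
  refine Set.ncard_congr (fun v hv => s(v, hv.2.choose)) (fun v hv => hv.2.choose_spec) ?_ ?_
  · intro v w hv hw e
    have hc := color_ne hw.2.choose_spec.adj_sub
    rcases Sym2.eq_iff.1 e with ⟨h, -⟩ | ⟨h, -⟩
    · exact h
    · rw [← h, hv.1, hw.1] at hc
      exact (hc rfl).elim
  · intro e he
    induction e using Sym2.ind with
    | _ v w =>
    have hvw : M.Adj v w := he
    have hc := color_ne hvw.adj_sub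
    cases hv : N.color v
    · refine ⟨v, ⟨hv, w, hvw⟩, ?_⟩
      rw [hM.eq_of_adj_left (Exists.choose_spec (⟨w, hvw⟩ : ∃ w, M.Adj v w)) hvw]
    · refine ⟨w, ⟨by simp_all, v, hvw.symm⟩, ?_⟩
      rw [hM.eq_of_adj_left (Exists.choose_spec (⟨v, hvw.symm⟩ : ∃ v, M.Adj w v)) hvw.symm]
      exact Sym2.eq_swap

/-! ### Augmenting paths are augmenting walks -/

end Network

lemma IsAugmentingPath.odd_length {V : Type*} {G : SimpleGraph V} {M : G.Subgraph} {a b : V}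
    {p : G.Walk a b} (hp : IsAugmentingPath M p) : Odd p.length := by
  obtain ⟨-, h0, -, hb, h⟩ := hp
  by_contra hodd
  have he : Odd (p.length - 1) := Nat.Even.sub_odd h0 (Nat.not_odd_iff_even.1 hodd) odd_one
  have := (h (p.length - 1) (by omega)).2 he
  rw [Nat.sub_add_cancel h0, p.getVert_length] at this
  exact hb _ this.symm

lemma IsAugmentingPath.reverse {V : Type*} {G : SimpleGraph V} {M : G.Subgraph} {a b : V}
    {p : G.Walk a b} (hp : IsAugmentingPath M p) : IsAugmentingPath M p.reverse := by
  have hodd := hp.odd_length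
  obtain ⟨h1, h0, ha, hb, h⟩ := hp
  refine ⟨h1.reverse, by simpa using h0, hb, ha, fun i hi => ?_⟩
  rw [SimpleGraph.Walk.length_reverse] at hi
  rw [SimpleGraph.Walk.getVert_reverse, SimpleGraph.Walk.getVert_reverse, M.adj_comm]
  have := h (p.length - (i + 1)) (by omega)
  rw [show p.length - (i + 1) + 1 = p.length - i by omega] at this
  rw [this]
  grind

namespace Network

variable {N : Network.{u} Δ}

lemma color_getVert {a b : N.V} (p : N.G.Walk a b) {i : ℕ} (hi : i ≤ p.length) :
    N.color (p.getVert i) = N.color a ↔ Even i := by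
  induction i with
  | zero => simp
  | succ i ih =>
    have hc := color_ne (p.adj_getVert_succ (i := i) (by omega))
    rw [Nat.even_add_one, ← ih (by omega)]
    cases h1 : N.color (p.getVert i) <;> cases h2 : N.color (p.getVert (i + 1)) <;>
      cases h3 : N.color a <;> simp_all

lemma le_length_of_isAugmentingPath_of_black {M : N.G.Subgraph} {n : ℕ}
    (hn : N.NoShort M.Adj n) {a b : N.V} {p : N.G.Walk a b} (hp : IsAugmentingPath M p)
    (hc : N.color a = false) : n ≤ p.length := by
  have hodd := hp.odd_length
  obtain ⟨-, -, ha, hb, h⟩ := hp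
  have hcol : ∀ i ≤ p.length, N.color (p.getVert i) = true ↔ Odd i := by
    intro i hi
    rw [← Nat.not_even_iff_odd, ← color_getVert p hi, hc, Bool.not_eq_false]
  have key : ∀ i ≤ p.length, ∃ l, N.WalkTo M.Adj l (p.getVert i) ∧ l.length = i := by
    intro i
    induction i with
    | zero => exact fun _ => ⟨[], by simpa using ⟨hc, ha⟩, rfl⟩
    | succ i ih =>
      intro hi
      obtain ⟨l, hl, rfl⟩ := ih (by omega)
      have hadj := p.adj_getVert_succ (i := l.length) (by omega)
      obtain ⟨q, r, hk⟩ := exists_link hadj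
      refine ⟨(q, r) :: l, ⟨_, hk.symm, ⟨hadj, ?_⟩, hl⟩, rfl⟩
      rw [h _ (by omega), hcol _ (by omega)]
  obtain ⟨l, hl, he⟩ := key _ le_rfl
  have hcb := (hcol _ le_rfl).2 hodd
  rw [p.getVert_length] at hl hcb
  exact he ▸ hn l b hl ⟨hcb, hb⟩

lemma le_length_of_isAugmentingPath {M : N.G.Subgraph} {n : ℕ} (hn : N.NoShort M.Adj n)
    {a b : N.V} {p : N.G.Walk a b} (hp : IsAugmentingPath M p) : n ≤ p.length := by
  cases hc : N.color a
  · exact le_length_of_isAugmentingPath_of_black hn hp hc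
  · rw [← p.length_reverse]
    refine le_length_of_isAugmentingPath_of_black hn hp.reverse ?_
    have := color_getVert p le_rfl
    rw [p.getVert_length, hc] at this
    rw [← Bool.not_eq_true, this, Nat.not_even_iff_odd]
    exact hp.odd_length

end Network

end PortLocal

theorem mainTheorem3 (Δ : ℕ) (hΔ : 1 ≤ Δ) (ε : ℝ) (hε : 0 < ε) :
    ∃ (A : PortLocal.DistAlgorithm Δ) (T : ℕ),
      ∀ (V : Type*) [Finite V] (G : SimpleGraph V) [G.LocallyFinite]
        (hdeg : ∀ v, G.degree v ≤ Δ) (c : G.Coloring Bool) (P : PortLocal.PortNumbering G),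
        ∃ M : G.Subgraph, M.IsMatching ∧ A.Outputs P hdeg c T M ∧
          (∀ M' : G.Subgraph, M'.IsMatching →
            (M'.edgeSet.ncard : ℝ) ≤ (1 + ε) * (M.edgeSet.ncard : ℝ)) ∧
          (∀ (a b : V) (p : G.Walk a b), PortLocal.IsAugmentingPath M p →
            2 * ⌈1 / ε⌉₊ - 1 < p.length) := by
  set k := ⌈1 / ε⌉₊ with hk
  obtain ⟨R, A, T, h⟩ := PortLocal.MatchingRule.exists_computedBy Δ (2 * k)
  obtain ⟨A', hA'⟩ := h.knownBy.exists_outputs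
  refine ⟨A', T, fun V _ G _ hdeg c P => ?_⟩
  let N : PortLocal.Network Δ := ⟨V, G, hdeg, c, P⟩
  have : Finite N.V := ‹Finite V›
  have hR := h.isMatchingRel N
  have hM : hR.toSubgraph.IsMatching := hR.isMatching
  refine ⟨hR.toSubgraph, hM, hA' N, fun M' hM' => ?_, fun a b p hp => ?_⟩
  · have h1 : M'.edgeSet.ncard = _ := PortLocal.Network.ncard_edgeSet (N := N) hM'
    have h2 : hR.toSubgraph.edgeSet.ncard = _ := PortLocal.Network.ncard_edgeSet (N := N) hM
    have h3 := PortLocal.Network.mul_ncard_black_le hR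
      (PortLocal.Network.isMatchingRel_adj (N := N) hM') (h.noShort N)
    rw [← h1] at h3
    replace h3 : k * M'.edgeSet.ncard ≤ (k + 1) * hR.toSubgraph.edgeSet.ncard := by
      rw [h2]
      exact h3
    have h4 : (k : ℝ) * M'.edgeSet.ncard ≤ (k + 1) * hR.toSubgraph.edgeSet.ncard := by
      exact_mod_cast h3
    have h5 : 1 ≤ ε * k := by
      have := Nat.le_ceil (1 / ε)
      rwa [div_le_iff₀' hε] at this
    have h6 : (0 : ℝ) < k := Nat.cast_pos.2 (Nat.ceil_pos.2 (by positivity))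
    have h7 : (0 : ℝ) ≤ hR.toSubgraph.edgeSet.ncard := Nat.cast_nonneg _
    refine le_of_mul_le_mul_left (h4.trans ?_) h6
    nlinarith
  · have h1 : 2 * k ≤ p.length := PortLocal.Network.le_length_of_isAugmentingPath (N := N)
      (M := hR.toSubgraph) (h.noShort N) hp
    have h2 : 0 < k := Nat.ceil_pos.2 (by positivity)
    omega
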